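/- Let $n\ge 1$, let $\kappa>0$, and let $A=[a_{ij}]\in\mathbb C^{n\times n}$ with $a_{ii}=0$ for all $i$. Let $\mathcal G(A)$ be the digraph on $\{1,\dots,n\}$ with an edge from $j$ to $i$ if and only if $a_{ij}\ne 0$; it has a directed spanning tree if some vertex has a directed path to every other vertex. Let $L=D-A$ with $D=\operatorname{diag}(d_1,\dots,d_n)$, $d_i=\sum_{j}|a_{ij}|$. Let $\mathbb T=\{w\in\mathbb C: |w|=1\}$ and, for $\zeta\in\mathbb T^n$, $D_\zeta=\operatorname{diag}(\zeta)$. The matrix $A$ is called essentially nonnegative if there is $\zeta\in\mathbb T^n$ such that all entries of $D_\zeta^{-1}AD_\zeta$ are real and nonnegative. The system $\dot z(t)=-\kappa Lz(t)$, $t\ge 0$, $z(t)\in\mathbb C^n$, is said to reach complex consensus if for (Lebesgue) almost every initial state $z(0)\in\mathbb C^n$ there is $a>0$ with $\lim_{t\to\infty}|z_i(t)|=a$ for all $i=1,\dots,n$. Then the system reaches complex consensus if and only if $A$ is essentially nonnegative and $\mathcal G(A)$ has a directed spanning tree. In this case, there is $\zeta\in\mathbb T^n$ with $L\zeta=0$,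 and every solution of $Ly=0$ is a scalar multiple of $\zeta$; for each such $\zeta$ there is a unique vector of the form $\eta=D_\zeta^{-1}\nu$ where $\nu$ has real nonnegative entries, $\|\nu\|_1=1$ and $\nu^T D_\zeta^{-1}LD_\zeta=0$; it satisfies $\|\eta\|_1=1$ and $\eta^TL=0$; and for every initial state $z(0)\in\mathbb C^n$ $$\lim_{t\to\infty}z(t)=(\eta^Tz(0))\,\zeta .$$ -/

import Mathlib

open Filter Topology MeasureTheory

noncomputable section

namespace ComplexConsensus

/-- The digraph of `A`: there is an edge from `j` to `i` iff `a_{ij} ≠ 0`. -/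
def graph {n : ℕ} (A : Matrix (Fin n) (Fin n) ℂ) : Digraph (Fin n) where
  Adj j i := A i j ≠ 0

/-- Some vertex (a root) has a directed path to every vertex. -/
def HasSpanningTree {n : ℕ} (G : Digraph (Fin n)) : Prop :=
  ∃ r, ∀ i, Relation.ReflTransGen G.Adj r i

/-- The complex Laplacian `L = D - A`, with `D = diag (d_1, …, d_n)` and `d_i = ∑_j |a_{ij}|`
(the terms with `a_{ij} = 0` contribute nothing, so this is the sum over the neighbours). -/
def laplacian {n : ℕ} (A : Matrix (Fin n) (Fin n) ℂ) : Matrix (Fin n) (Fin n) ℂ :=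
  Matrix.diagonal (fun i => ((∑ j, ‖A i j‖ : ℝ) : ℂ)) - A

/-- `ζ ∈ 𝕋ⁿ`. -/
def IsUnimodular {n : ℕ} (ζ : Fin n → ℂ) : Prop := ∀ i, ‖ζ i‖ = 1

/-- All entries are real and nonnegative. -/
def IsNonnegative {n : ℕ} (B : Matrix (Fin n) (Fin n) ℂ) : Prop :=
  ∀ i j, 0 ≤ (B i j).re ∧ (B i j).im = 0

/-- The matrix `D_ζ⁻¹ M D_ζ`, where `D_ζ = diag ζ`. -/
def switch {n : ℕ} (ζ : Fin n → ℂ) (M : Matrix (Fin n) (Fin n) ℂ) : Matrix (Fin n) (Fin n) ℂ :=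
  (Matrix.diagonal ζ)⁻¹ * M * Matrix.diagonal ζ

def SwitchingEquivalent {n : ℕ} (A₁ A₂ : Matrix (Fin n) (Fin n) ℂ) : Prop :=
  ∃ ζ : Fin n → ℂ, IsUnimodular ζ ∧ A₂ = switch ζ A₁

def EssentiallyNonnegative {n : ℕ} (A : Matrix (Fin n) (Fin n) ℂ) : Prop :=
  ∃ B, IsNonnegative B ∧ SwitchingEquivalent A B

/-- `z` solves `ż = -κ L z` on `[0, ∞)` (with the right derivative at `0`). -/
def IsTrajectory {n : ℕ} (κ : ℝ) (A : Matrix (Fin n) (Fin n) ℂ) (z : ℝ → Fin n → ℂ) : Prop :=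
  ∀ t, 0 ≤ t →
    HasDerivWithinAt z (-((κ : ℂ) • (laplacian A).mulVec (z t))) (Set.Ici 0) t

/-- All the moduli `|z_i(t)|` tend to one and the same positive limit. -/
def HasPositiveCommonModulus {n : ℕ} (z : ℝ → Fin n → ℂ) : Prop :=
  ∃ a : ℝ, 0 < a ∧ ∀ i, Tendsto (fun t => ‖z t i‖) atTop (𝓝 a)

/-- The system `ż = -κ L z` reaches complex consensus: for (Lebesgue) almost every initial state
the moduli of all the agents tend to one and the same positive limit. No linear system has this
property for every initial state, since the solution that starts at `0` stays there. -/
def ReachesComplexConsensus {n : ℕ} (κ : ℝ) (A : Matrix (Fin n) (Fin n) ℂ) : Prop :=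
  ∀ᵐ z₀ : Fin n → ℂ, ∀ z : ℝ → Fin n → ℂ,
    IsTrajectory κ A z → z 0 = z₀ → HasPositiveCommonModulus z

/-- `‖x‖₁`. -/
def oneNorm {n : ℕ} (x : Fin n → ℂ) : ℝ := ∑ i, ‖x i‖

/-- `η = D_ζ⁻¹ ν`, where `ν` is a nonnegative left zero-eigenvector of `D_ζ⁻¹ L D_ζ`
with `‖ν‖₁ = 1`. -/
def IsNormalizedLeftEigenvector {n : ℕ} (A : Matrix (Fin n) (Fin n) ℂ) (ζ η : Fin n → ℂ) : Prop :=
  ∃ ν : Fin n → ℂ, (∀ i, 0 ≤ (ν i).re ∧ (ν i).im = 0) ∧ oneNorm ν = 1 ∧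
    Matrix.vecMul ν (switch ζ (laplacian A)) = 0 ∧ η = (Matrix.diagonal ζ)⁻¹.mulVec ν

end ComplexConsensus

end

/-! In the sup norm the semigroup `exp (-tκL)` is contractive: `-tκL` plus a large scalar `s` has
operator norm at most `s`, and the factor `e^{-s}` compensates. By Gershgorin the spectrum of `-κL`
lies in discs of the left half-plane touching the imaginary axis only at `0`, and boundedness rules
out Jordan blocks at `0`. So the semigroup converges to a contractive projection `P` onto `ker L`
with `P L = 0` (`exists_limit_projection`).

Equality in the triangle inequality links `ker L` to the structure of `A`. A unimodular kernel
vector exists iff `A` is essentially nonnegative (`essentiallyNonnegative_iff`). With a spanning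
tree a maximum principle makes the kernel one-dimensional, so `P x = (η ⬝ᵥ x) • ζ`; `‖P‖ ≤ 1` gives
`‖η‖₁ ≤ 1`, and with `η ⬝ᵥ ζ = 1` this forces every `η i * ζ i ≥ 0`. Consensus then fails only on
the null hyperplane `η ⬝ᵥ x = 0`.

Conversely, almost-everywhere consensus extends by density to equal moduli of all entries of `P x`
for every `x`. Normalizing a nonzero `P x` gives `ζ`; without a spanning tree, two disjoint
autonomous sets of vertices could be given limits `0` and `ζ`. -/

noncomputable section

namespace ComplexConsensus

/-! ### Bounded one-parameter semigroups and their limits. -/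

section Semigroup

variable {E : Type*} [NormedAddCommGroup E] [NormedSpace ℂ E]

theorem exp_zero_smul_apply (T : E →L[ℂ] E) (x : E) : NormedSpace.exp ((0 : ℝ) • T) x = x := by
  simp

theorem exp_smul_apply_comm (T : E →L[ℂ] E) (x : E) (t : ℝ) :
    NormedSpace.exp (t • T) (T x) = T (NormedSpace.exp (t • T) x) := by
  have h : Commute T (NormedSpace.exp (t • T)) :=
    Commute.exp_right ((Commute.refl T).smul_right t)
  exact (DFunLike.congr_fun h.eq x).symm

variable [CompleteSpace E]

theorem hasSum_exp_apply (T : E →L[ℂ] E) (x : E) :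
    HasSum (fun k : ℕ => (k.factorial : ℂ)⁻¹ • (T ^ k) x) (NormedSpace.exp T x) := by
  have h := NormedSpace.exp_series_hasSum_exp' (𝕂 := ℂ) T
  simpa using h.mapL (ContinuousLinearMap.apply ℂ E x)

theorem norm_exp_le_exp_norm [Nontrivial E] (T : E →L[ℂ] E) :
    ‖NormedSpace.exp T‖ ≤ Real.exp ‖T‖ := by
  have h := NormedSpace.exp_series_hasSum_exp' (𝕂 := ℂ) T
  have h' := NormedSpace.exp_series_hasSum_exp' (𝕂 := ℝ) ‖T‖
  rw [← Real.exp_eq_exp_ℝ] at h'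
  rw [← h.tsum_eq]
  refine tsum_of_norm_bounded h' fun k => ?_
  rw [norm_smul, norm_inv, smul_eq_mul]
  simp only [RCLike.norm_natCast]
  gcongr
  exact norm_pow_le T k

theorem exp_add_algebraMap (T : E →L[ℂ] E) (c : ℂ) :
    NormedSpace.exp (algebraMap ℂ (E →L[ℂ] E) c + T) = Complex.exp c • NormedSpace.exp T := by
  let _ : NormedAlgebra ℚ (E →L[ℂ] E) := NormedAlgebra.restrictScalars ℚ ℂ _
  rw [NormedSpace.exp_add_of_commute (Algebra.commutes c T), ← NormedSpace.algebraMap_exp_comm,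
    ← Complex.exp_eq_exp_ℂ, Algebra.smul_def]

theorem exp_apply_mem {T : E →L[ℂ] E} {V : Submodule ℂ E} (hV : IsClosed (V : Set E))
    (h : ∀ x ∈ V, T x ∈ V) {x : E} (hx : x ∈ V) : NormedSpace.exp T x ∈ V := by
  have hk : ∀ k : ℕ, (T ^ k) x ∈ V := by
    intro k
    induction k with
    | zero => simpa using hx
    | succ k ih => rw [pow_succ']; exact h _ ih
  exact hV.mem_of_tendsto (hasSum_exp_apply T x)
    (Eventually.of_forall fun s => V.sum_mem fun k _ => V.smul_mem _ (hk k))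

theorem exp_apply_eq_sum {T : E →L[ℂ] E} {x : E} {k : ℕ} (h : (T ^ k) x = 0) :
    NormedSpace.exp T x = ∑ j ∈ Finset.range k, (j.factorial : ℂ)⁻¹ • (T ^ j) x := by
  refine (hasSum_exp_apply T x).unique (hasSum_sum_of_ne_finset_zero fun j hj => ?_)
  obtain ⟨i, rfl⟩ := Nat.exists_eq_add_of_le' (Finset.mem_range.not.mp hj |> not_lt.mp)
  rw [pow_add, mul_apply_eq_comp, h, map_zero, smul_zero]

/-- A functional that vanishes on the range of `T` is invariant under `exp T`. -/
theorem apply_exp_apply_of_forall_apply_eq_zero {T : E →L[ℂ] E} {φ : E →L[ℂ] ℂ}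
    (h : ∀ x, φ (T x) = 0) (x : E) : φ (NormedSpace.exp T x) = φ x := by
  refine ((hasSum_exp_apply T x).mapL φ).unique ?_
  convert hasSum_single (f := fun k : ℕ => φ ((k.factorial : ℂ)⁻¹ • (T ^ k) x)) 0 fun k hk => ?_
  · simp
  · obtain ⟨k, rfl⟩ := Nat.exists_eq_succ_of_ne_zero hk
    rw [map_smul, Nat.succ_eq_add_one, pow_succ', mul_apply_eq_comp, h, smul_zero]

theorem hasDerivAt_exp_smul_apply (T : E →L[ℂ] E) (x : E) (t : ℝ) :
    HasDerivAt (fun s : ℝ => NormedSpace.exp (s • T) x) (T (NormedSpace.exp (t • T) x)) t := by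
  have h := hasDerivAt_exp_smul_const' (𝕂 := ℝ) T t
  exact ((ContinuousLinearMap.apply ℂ E x).restrictScalars ℝ).hasFDerivAt.comp_hasDerivAt t h

theorem exp_smul_apply_of_apply_eq_zero {T : E →L[ℂ] E} {x : E} (h : T x = 0) (t : ℝ) :
    NormedSpace.exp (t • T) x = x := by
  rw [exp_apply_eq_sum (k := 1) (by simp [h])]
  simp

/-- On a generalized eigenvector the exponential series of the nilpotent part terminates, leaving
`e^{tμ}` times a polynomial in `t`. -/
theorem tendsto_exp_smul_apply_of_pow_eq_zero {T : E →L[ℂ] E} {x : E} {k : ℕ} {μ : ℂ}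
    (hμ : μ.re < 0) (h : ((T - algebraMap ℂ (E →L[ℂ] E) μ) ^ k) x = 0) :
    Tendsto (fun t : ℝ => NormedSpace.exp (t • T) x) atTop (𝓝 0) := by
  set N := T - algebraMap ℂ (E →L[ℂ] E) μ with hN
  have key : ∀ t : ℝ, NormedSpace.exp (t • T) x =
      ∑ j ∈ Finset.range k, (Complex.exp (t * μ) * (t : ℂ) ^ j) •
        ((j.factorial : ℂ)⁻¹ • (N ^ j) x) := by
    intro t
    have hT : t • T = algebraMap ℂ (E →L[ℂ] E) (t * μ) + (t : ℂ) • N := by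
      rw [hN, smul_sub, map_mul, ← Algebra.smul_def, add_sub_cancel]
      exact (Complex.coe_smul t T).symm
    have hk : (((t : ℂ) • N) ^ k) x = 0 := by simp [smul_pow, h]
    rw [hT, exp_add_algebraMap, smul_apply, exp_apply_eq_sum hk,
      Finset.smul_sum]
    refine Finset.sum_congr rfl fun j _ => ?_
    rw [smul_pow, smul_apply, smul_smul, smul_smul, smul_smul]
    ring_nf
  simp_rw [key]
  rw [show (0 : E) = ∑ j ∈ Finset.range k, (0 : ℂ) • ((j.factorial : ℂ)⁻¹ • (N ^ j) x) by simp]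
  refine tendsto_finsetSum _ fun j _ => Tendsto.smul_const ?_ _
  rw [tendsto_zero_iff_norm_tendsto_zero]
  have hlim := tendsto_rpow_mul_exp_neg_mul_atTop_nhds_zero j (-μ.re) (by linarith)
  refine hlim.congr' ?_
  filter_upwards [eventually_ge_atTop (0 : ℝ)] with t ht
  rw [norm_mul, Complex.norm_exp, norm_pow, Complex.norm_real, Real.norm_of_nonneg ht, mul_comm,
    Real.rpow_natCast]
  simp [mul_comm]

/-- A Jordan chain of length two at `0` would give the orbit `x + t • T x`, which grows linearly and
contradicts boundedness. -/
theorem apply_eq_zero_of_apply_apply_eq_zero {T : E →L[ℂ] E} {C : ℝ}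
    (hC : ∀ t : ℝ, 0 ≤ t → ‖NormedSpace.exp (t • T)‖ ≤ C) {x : E} (h : T (T x) = 0) :
    T x = 0 := by
  by_contra hx
  have hpos : 0 < ‖T x‖ := norm_pos_iff.mpr hx
  have key : ∀ t : ℝ, NormedSpace.exp (t • T) x = x + (t : ℂ) • T x := by
    intro t
    rw [exp_apply_eq_sum (k := 2) (by simp [pow_two, h])]
    simp [Finset.sum_range_succ]
  have hb : ∀ t : ℝ, 0 ≤ t → t * ‖T x‖ ≤ C * ‖x‖ + ‖x‖ := by
    intro t ht
    have h1 : (t : ℂ) • T x = NormedSpace.exp (t • T) x - x := by rw [key]; abel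
    calc t * ‖T x‖ = ‖(t : ℂ) • T x‖ := by
          rw [norm_smul, Complex.norm_real, Real.norm_of_nonneg ht]
      _ ≤ ‖NormedSpace.exp (t • T) x‖ + ‖x‖ := by rw [h1]; exact norm_sub_le _ _
      _ ≤ C * ‖x‖ + ‖x‖ := by
          gcongr
          exact ContinuousLinearMap.le_of_opNorm_le _ (hC t ht) x
  have hlim : Tendsto (fun t : ℝ => t * ‖T x‖) atTop atTop := tendsto_id.atTop_mul_const hpos
  obtain ⟨t, ht0, ht⟩ :=
    ((eventually_ge_atTop (0 : ℝ)).and (hlim.eventually_gt_atTop (C * ‖x‖ + ‖x‖))).exists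
  exact absurd (hb t ht0) (not_le.mpr ht)

theorem apply_eq_zero_of_pow_apply_eq_zero {T : E →L[ℂ] E} {C : ℝ}
    (hC : ∀ t : ℝ, 0 ≤ t → ‖NormedSpace.exp (t • T)‖ ≤ C) {x : E} {k : ℕ}
    (h : (T ^ k) x = 0) : T x = 0 := by
  induction k generalizing x with
  | zero => simp_all
  | succ k ih =>
    rw [pow_succ, mul_apply_eq_comp] at h
    exact apply_eq_zero_of_apply_apply_eq_zero hC (ih h)

/-- A bounded semigroup whose generator has no eigenvalue with nonnegative real part except `0`
converges pointwise to elements of the kernel of the generator. -/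
theorem exists_tendsto_exp_smul_apply [FiniteDimensional ℂ E] {T : E →L[ℂ] E} {C : ℝ}
    (hC : ∀ t : ℝ, 0 ≤ t → ‖NormedSpace.exp (t • T)‖ ≤ C)
    (hT : ∀ μ : ℂ, Module.End.HasEigenvalue (T : E →ₗ[ℂ] E) μ → μ = 0 ∨ μ.re < 0) (x : E) :
    ∃ y, T y = 0 ∧ Tendsto (fun t : ℝ => NormedSpace.exp (t • T) x) atTop (𝓝 y) := by
  have hx : x ∈ ⨆ μ : ℂ, Module.End.maxGenEigenspace (T : E →ₗ[ℂ] E) μ := by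
    rw [Module.End.iSup_maxGenEigenspace_eq_top]; trivial
  refine Submodule.iSup_induction _ (motive := fun x => ∃ y, T y = 0 ∧
    Tendsto (fun t : ℝ => NormedSpace.exp (t • T) x) atTop (𝓝 y)) hx ?_ ?_ ?_
  · intro μ x hx
    obtain ⟨k, hk⟩ := (Module.End.mem_maxGenEigenspace _ _ _).mp hx
    have hk' : ((T - algebraMap ℂ (E →L[ℂ] E) μ) ^ k) x = 0 := by
      have hcoe : ∀ (j : ℕ) (v : E), ((T - algebraMap ℂ (E →L[ℂ] E) μ) ^ j) v =
          (((T : E →ₗ[ℂ] E) - μ • 1) ^ j) v := by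
        intro j
        induction j with
        | zero => simp
        | succ j ih =>
          intro v
          rw [pow_succ, pow_succ, mul_apply_eq_comp, Module.End.mul_apply, ih]
          simp [Algebra.algebraMap_eq_smul_one]
      rw [hcoe, hk]
    by_cases hx0 : x = 0
    · exact ⟨0, map_zero T, by simp [hx0]⟩
    have hμ : Module.End.HasEigenvalue (T : E →ₗ[ℂ] E) μ := by
      refine Module.End.hasEigenvalue_of_hasGenEigenvalue (k := k) ?_
      intro hbot
      apply hx0
      have : x ∈ Module.End.genEigenspace (T : E →ₗ[ℂ] E) μ k := by
        rw [Module.End.mem_genEigenspace_nat]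
        exact hk
      rwa [hbot] at this
    rcases hT μ hμ with rfl | hneg
    · rw [map_zero, sub_zero] at hk'
      have hTx := apply_eq_zero_of_pow_apply_eq_zero hC hk'
      exact ⟨x, hTx, by simp_rw [exp_smul_apply_of_apply_eq_zero hTx]; exact tendsto_const_nhds⟩
    · exact ⟨0, map_zero T, tendsto_exp_smul_apply_of_pow_eq_zero hneg hk'⟩
  · exact ⟨0, map_zero T, by simp⟩
  · rintro x₁ x₂ ⟨y₁, h₁, h₁'⟩ ⟨y₂, h₂, h₂'⟩
    exact ⟨y₁ + y₂, by rw [map_add, h₁, h₂, add_zero], by simpa using h₁'.add h₂'⟩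

/-- The solutions of `ż = T z` on `[0, ∞)` are given by the exponential. -/
theorem eq_exp_smul_apply_of_hasDerivWithinAt {T : E →L[ℂ] E} {z : ℝ → E}
    (hz : ∀ t, 0 ≤ t → HasDerivWithinAt z (T (z t)) (Set.Ici 0) t) {t : ℝ} (ht : 0 ≤ t) :
    z t = NormedSpace.exp (t • T) (z 0) := by
  refine ODE_solution_unique (f := z) (g := fun s => NormedSpace.exp (s • T) (z 0))
    (v := fun _ => T) (K := ‖T‖₊) (a := 0) (b := t) (fun _ => T.lipschitz)
    (fun s hs => ?_) (fun s hs => ?_) (fun s _ => ?_) (fun s _ => ?_) ?_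
    ⟨ht, le_rfl⟩
  · exact (hz s hs.1).continuousWithinAt.mono Set.Icc_subset_Ici_self
  · exact (hz s hs.1).mono (Set.Ici_subset_Ici.mpr hs.1)
  · exact (hasDerivAt_exp_smul_apply T (z 0) s).continuousAt.continuousWithinAt
  · exact (hasDerivAt_exp_smul_apply T (z 0) s).hasDerivWithinAt
  · simp

end Semigroup

/-! ### The Laplacian semigroup: contractivity, spectrum, limit projection. -/

variable {n : ℕ}

theorem laplacian_mulVec_apply (A : Matrix (Fin n) (Fin n) ℂ) (y : Fin n → ℂ) (i : Fin n) :
    (laplacian A).mulVec y i = ((∑ j, ‖A i j‖ : ℝ) : ℂ) * y i - ∑ j, A i j * y j := by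
  rw [laplacian, Matrix.sub_mulVec, Pi.sub_apply, Matrix.mulVec_diagonal]
  rfl

/-- The generator `-κ L` of the system as a continuous linear map. -/
def generator (κ : ℝ) (A : Matrix (Fin n) (Fin n) ℂ) : (Fin n → ℂ) →L[ℂ] (Fin n → ℂ) :=
  LinearMap.toContinuousLinearMap (Matrix.toLin' (-((κ : ℂ) • laplacian A)))

theorem generator_apply (κ : ℝ) (A : Matrix (Fin n) (Fin n) ℂ) (x : Fin n → ℂ) :
    generator κ A x = -((κ : ℂ) • (laplacian A).mulVec x) := by
  simp [generator, Matrix.smul_mulVec]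

theorem generator_apply_eq_zero_iff {κ : ℝ} (hκ : 0 < κ) {A : Matrix (Fin n) (Fin n) ℂ}
    {x : Fin n → ℂ} : generator κ A x = 0 ↔ (laplacian A).mulVec x = 0 := by
  simp [generator_apply, hκ.ne']

theorem norm_exp_generator_le (hn : 0 < n) {κ : ℝ} (hκ : 0 < κ) (A : Matrix (Fin n) (Fin n) ℂ)
    {t : ℝ} (ht : 0 ≤ t) : ‖NormedSpace.exp (t • generator κ A)‖ ≤ 1 := by
  have : Nonempty (Fin n) := ⟨⟨0, hn⟩⟩
  -- Any common upper bound of the row sums `d_i` would do; it keeps the diagonal of the shifted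
  -- matrix `R` nonnegative.
  set m : ℝ := ∑ i, ∑ j, ‖A i j‖ with hm
  have hm0 : 0 ≤ m := by positivity
  set R : (Fin n → ℂ) →L[ℂ] (Fin n → ℂ) :=
    t • generator κ A + algebraMap ℂ _ ((t * κ * m : ℝ) : ℂ) with hR
  have hRn : ‖R‖ ≤ t * κ * m := by
    refine ContinuousLinearMap.opNorm_le_bound _ (by positivity) fun x => ?_
    rw [pi_norm_le_iff_of_nonneg (by positivity)]
    intro i
    have hd : ∑ j, ‖A i j‖ ≤ m :=
      Finset.single_le_sum (f := fun i => ∑ j, ‖A i j‖)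
        (fun i _ => Finset.sum_nonneg fun j _ => norm_nonneg _) (Finset.mem_univ i)
    have hRx : R x i = ((t * κ : ℝ) : ℂ) *
        (((m - ∑ j, ‖A i j‖ : ℝ) : ℂ) * x i + ∑ j, A i j * x j) := by
      have h1 : R x i = (t : ℂ) * -((κ : ℂ) * (laplacian A).mulVec x i) +
          ((t * κ * m : ℝ) : ℂ) * x i := by
        simp [hR, generator_apply, Algebra.algebraMap_eq_smul_one]
      rw [h1, laplacian_mulVec_apply]
      push_cast
      ring
    rw [hRx, norm_mul, Complex.norm_real, Real.norm_of_nonneg (by positivity), mul_assoc (t * κ)]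
    gcongr
    calc ‖((m - ∑ j, ‖A i j‖ : ℝ) : ℂ) * x i + ∑ j, A i j * x j‖
        ≤ ‖((m - ∑ j, ‖A i j‖ : ℝ) : ℂ) * x i‖ + ∑ j, ‖A i j * x j‖ :=
          (norm_add_le _ _).trans (by gcongr; exact norm_sum_le _ _)
      _ ≤ (m - ∑ j, ‖A i j‖) * ‖x‖ + ∑ j, ‖A i j‖ * ‖x‖ := by
          rw [norm_mul, Complex.norm_real, Real.norm_of_nonneg (by linarith)]
          gcongr with j
          · exact norm_le_pi_norm x i
          · rw [norm_mul]
            gcongr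
            exact norm_le_pi_norm x j
      _ = m * ‖x‖ := by rw [← Finset.sum_mul]; ring
  have hgen : t • generator κ A = algebraMap ℂ _ (((-(t * κ * m)) : ℝ) : ℂ) + R := by
    rw [hR, Complex.ofReal_neg, map_neg]; abel
  rw [hgen, exp_add_algebraMap, norm_smul, Complex.norm_exp, Complex.ofReal_re]
  calc Real.exp (-(t * κ * m)) * ‖NormedSpace.exp R‖
      ≤ Real.exp (-(t * κ * m)) * Real.exp (t * κ * m) := by
        gcongr
        exact (norm_exp_le_exp_norm R).trans (Real.exp_le_exp.mpr hRn)
    _ = 1 := by rw [← Real.exp_add]; simp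

/-- The disc is tangent to the imaginary axis at `0`: squaring gives `|μ|² ≤ -2r Re μ`. -/
theorem eq_zero_or_re_neg_of_norm_add_le {μ : ℂ} {r : ℝ} (hr : 0 ≤ r)
    (h : ‖μ + r‖ ≤ r) : μ = 0 ∨ μ.re < 0 := by
  by_contra! hcon
  obtain ⟨h0, hre⟩ := hcon
  have h2 : ‖μ + r‖ ^ 2 ≤ r ^ 2 := by gcongr
  rw [← Complex.normSq_eq_norm_sq, Complex.normSq_apply] at h2
  simp only [Complex.add_re, Complex.ofReal_re, Complex.add_im, Complex.ofReal_im, add_zero] at h2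
  have h3 : μ.re * μ.re + μ.im * μ.im ≤ 0 := by nlinarith [mul_nonneg hr hre]
  apply h0
  rw [← Complex.normSq_eq_zero]
  exact le_antisymm h3 (Complex.normSq_nonneg μ)

/-- Gershgorin: since `A` has zero diagonal, the `k`-th disc has centre `-κ d_k` and radius at most
`κ d_k`. -/
theorem eigenvalue_generator {κ : ℝ} (hκ : 0 < κ) {A : Matrix (Fin n) (Fin n) ℂ}
    (hA : ∀ i, A i i = 0) {μ : ℂ}
    (hμ : Module.End.HasEigenvalue
      ((generator κ A : (Fin n → ℂ) →L[ℂ] (Fin n → ℂ)) : (Fin n → ℂ) →ₗ[ℂ] (Fin n → ℂ)) μ) :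
    μ = 0 ∨ μ.re < 0 := by
  obtain ⟨k, hk⟩ := eigenvalue_mem_ball (A := -((κ : ℂ) • laplacian A)) hμ
  have hsum : ∑ j ∈ Finset.univ.erase k, ‖(-((κ : ℂ) • laplacian A)) k j‖ ≤
      κ * ∑ j, ‖A k j‖ := by
    rw [Finset.mul_sum]
    refine (Finset.sum_le_sum fun j hj => ?_).trans
      (Finset.sum_le_sum_of_subset_of_nonneg (Finset.erase_subset k Finset.univ)
        fun j _ _ => by positivity)
    simp [laplacian, Matrix.diagonal_apply_ne' _ (Finset.ne_of_mem_erase hj), abs_of_pos hκ]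
  have hdiag : (-((κ : ℂ) • laplacian A)) k k = -((κ * ∑ j, ‖A k j‖ : ℝ) : ℂ) := by
    simp [laplacian, hA]
  rw [mem_closedBall_iff_norm, hdiag, sub_neg_eq_add] at hk
  exact eq_zero_or_re_neg_of_norm_add_le (by positivity) (hk.trans hsum)

/-- The semigroup of the system converges pointwise to a contractive projection onto the kernel
of the Laplacian, along its range. -/
theorem exists_limit_projection (hn : 0 < n) {κ : ℝ} (hκ : 0 < κ) {A : Matrix (Fin n) (Fin n) ℂ}
    (hA : ∀ i, A i i = 0) :
    ∃ P : (Fin n → ℂ) →ₗ[ℂ] (Fin n → ℂ), (∀ x, (laplacian A).mulVec (P x) = 0) ∧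
      (∀ y, (laplacian A).mulVec y = 0 → P y = y) ∧ (∀ x, P ((laplacian A).mulVec x) = 0) ∧
      (∀ x, ‖P x‖ ≤ ‖x‖) ∧
      ∀ x, Tendsto (fun t : ℝ => NormedSpace.exp (t • generator κ A) x) atTop (𝓝 (P x)) := by
  choose P hP0 hP using exists_tendsto_exp_smul_apply (T := generator κ A)
    (fun t ht => norm_exp_generator_le hn hκ A ht) fun μ => eigenvalue_generator hκ hA
  let P' : (Fin n → ℂ) →ₗ[ℂ] (Fin n → ℂ) :=
    { toFun := P
      map_add' := fun x y => tendsto_nhds_unique (hP (x + y)) (by simpa using (hP x).add (hP y))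
      map_smul' := fun c x => tendsto_nhds_unique (hP (c • x)) (by simpa using (hP x).const_smul c) }
  have hfix : ∀ y, (laplacian A).mulVec y = 0 → P y = y := fun y hy => by
    refine tendsto_nhds_unique (hP y) ?_
    simp_rw [exp_smul_apply_of_apply_eq_zero ((generator_apply_eq_zero_iff hκ).mpr hy)]
    exact tendsto_const_nhds
  have hgen : ∀ x, P (generator κ A x) = 0 := fun x => by
    refine tendsto_nhds_unique (hP (generator κ A x)) ?_
    simp_rw [exp_smul_apply_comm]
    rw [← hP0 x]
    exact ((generator κ A).continuous.tendsto _).comp (hP x)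
  refine ⟨P', fun x => (generator_apply_eq_zero_iff hκ).mp (hP0 x), hfix, fun x => ?_, fun x => ?_,
    hP⟩
  · have h : P' (generator κ A x) = 0 := hgen x
    rw [generator_apply, map_neg, map_smul, neg_eq_zero, smul_eq_zero] at h
    exact h.resolve_left (by exact_mod_cast hκ.ne')
  · refine le_of_tendsto (hP x).norm ?_
    filter_upwards [eventually_ge_atTop (0 : ℝ)] with t ht
    simpa using ContinuousLinearMap.le_of_opNorm_le _ (norm_exp_generator_le hn hκ A ht) x

theorem IsTrajectory.eq_exp {κ : ℝ} {A : Matrix (Fin n) (Fin n) ℂ} {z : ℝ → Fin n → ℂ}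
    (hz : IsTrajectory κ A z) {t : ℝ} (ht : 0 ≤ t) :
    z t = NormedSpace.exp (t • generator κ A) (z 0) :=
  eq_exp_smul_apply_of_hasDerivWithinAt
    (fun s hs => by rw [generator_apply]; exact hz s hs) ht

theorem isTrajectory_exp (κ : ℝ) (A : Matrix (Fin n) (Fin n) ℂ) (x : Fin n → ℂ) :
    IsTrajectory κ A fun t => NormedSpace.exp (t • generator κ A) x := by
  intro t _
  have h := (hasDerivAt_exp_smul_apply (generator κ A) x t).hasDerivWithinAt (s := Set.Ici 0)
  rwa [generator_apply] at h

theorem IsTrajectory.tendsto {κ : ℝ} {A : Matrix (Fin n) (Fin n) ℂ} {z : ℝ → Fin n → ℂ}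
    (hz : IsTrajectory κ A z) {y : Fin n → ℂ}
    (h : Tendsto (fun t : ℝ => NormedSpace.exp (t • generator κ A) (z 0)) atTop (𝓝 y)) :
    Tendsto z atTop (𝓝 y) := by
  refine h.congr' ?_
  filter_upwards [eventually_ge_atTop (0 : ℝ)] with t ht using (hz.eq_exp ht).symm

/-! ### Kernel vectors of the Laplacian and equality in the triangle inequality. -/

open ComplexOrder in
theorem eq_coe_norm_of_re_nonneg {w : ℂ} (h : 0 ≤ w.re ∧ w.im = 0) : w = (‖w‖ : ℂ) :=
  Complex.eq_coe_norm_of_nonneg (Complex.nonneg_iff.mpr ⟨h.1, h.2.symm⟩)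

/-- The differences `c j - Re (b j)` are nonnegative with sum zero, so each vanishes, and then `Re
(b j) = ‖b j‖`. -/
theorem eq_ofReal_of_sum_eq {ι : Type*} [Fintype ι] {b : ι → ℂ} {c : ι → ℝ}
    (h : ∀ j, ‖b j‖ ≤ c j) (hs : ∑ j, b j = ((∑ j, c j : ℝ) : ℂ)) (j : ι) : b j = (c j : ℂ) := by
  have hre : ∑ j, (c j - (b j).re) = 0 := by
    have := congrArg Complex.re hs
    rw [Complex.re_sum, Complex.ofReal_re] at this
    rw [Finset.sum_sub_distrib, this, sub_self]
  have hj := (Finset.sum_eq_zero_iff_of_nonneg fun j _ =>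
    sub_nonneg.mpr ((Complex.re_le_norm (b j)).trans (h j))).mp hre j (Finset.mem_univ j)
  have hcj : (b j).re = c j := by linarith
  have hnorm : (b j).re = ‖b j‖ := le_antisymm (Complex.re_le_norm _) (hcj ▸ h j)
  rw [← hcj, hnorm]
  exact Complex.eq_coe_norm_of_nonneg (Complex.re_eq_norm.mp hnorm)

/-- At an entry of maximal modulus of a vector in the kernel of the Laplacian, the triangle
inequality is an equality. -/
theorem mul_eq_norm_mul_of_forall_norm_le {A : Matrix (Fin n) (Fin n) ℂ} {y : Fin n → ℂ}
    (hy : (laplacian A).mulVec y = 0) {i : Fin n} (hi : ∀ j, ‖y j‖ ≤ ‖y i‖) (j : Fin n) :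
    A i j * y j = ‖A i j‖ * y i := by
  by_cases h0 : y i = 0
  · have : y j = 0 := by simpa [h0] using hi j
    simp [h0, this]
  have hrow := congrFun hy i
  rw [laplacian_mulVec_apply, Pi.zero_apply, sub_eq_zero] at hrow
  have hb : ∀ j, ‖A i j * y j / y i‖ ≤ ‖A i j‖ := fun j => by
    rw [norm_div, norm_mul, div_le_iff₀ (norm_pos_iff.mpr h0)]
    gcongr
    exact hi j
  have hs : ∑ j, A i j * y j / y i = ((∑ j, ‖A i j‖ : ℝ) : ℂ) := by
    rw [← Finset.sum_div, ← hrow, mul_div_cancel_right₀ _ h0]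
  have := eq_ofReal_of_sum_eq hb hs j
  rwa [div_eq_iff h0] at this

theorem IsUnimodular.ne_zero {ζ : Fin n → ℂ} (hζ : IsUnimodular ζ) (i : Fin n) : ζ i ≠ 0 :=
  norm_ne_zero_iff.mp (by rw [hζ i]; exact one_ne_zero)

theorem IsUnimodular.inv_diagonal {ζ : Fin n → ℂ} (hζ : IsUnimodular ζ) :
    (Matrix.diagonal ζ)⁻¹ = Matrix.diagonal fun i => (ζ i)⁻¹ := by
  refine Matrix.inv_eq_left_inv ?_
  rw [Matrix.diagonal_mul_diagonal]
  simp [hζ.ne_zero]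

theorem IsUnimodular.switch_apply {ζ : Fin n → ℂ} (hζ : IsUnimodular ζ)
    (M : Matrix (Fin n) (Fin n) ℂ) (i j : Fin n) : switch ζ M i j = (ζ i)⁻¹ * M i j * ζ j := by
  rw [switch, hζ.inv_diagonal, Matrix.mul_diagonal, Matrix.diagonal_mul]

/-- Both sides amount to `A i j * ζ j = ‖A i j‖ * ζ i`. For a unimodular kernel vector every index
has maximal modulus, so this holds in every row. -/
theorem essentiallyNonnegative_iff {A : Matrix (Fin n) (Fin n) ℂ} :
    EssentiallyNonnegative A ↔ ∃ ζ, IsUnimodular ζ ∧ (laplacian A).mulVec ζ = 0 := by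
  constructor
  · rintro ⟨B, hB, ζ, hζ, rfl⟩
    refine ⟨ζ, hζ, ?_⟩
    funext i
    rw [laplacian_mulVec_apply, Pi.zero_apply, Complex.ofReal_sum, Finset.sum_mul, sub_eq_zero]
    refine Finset.sum_congr rfl fun j _ => ?_
    have h := eq_coe_norm_of_re_nonneg (hB i j)
    rw [hζ.switch_apply, norm_mul, norm_mul, norm_inv, hζ i, hζ j, inv_one, one_mul, mul_one] at h
    rw [← h]
    field_simp [hζ.ne_zero i]
  · rintro ⟨ζ, hζ, h⟩
    refine ⟨switch ζ A, fun i j => ?_, ζ, hζ, rfl⟩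
    have hij := mul_eq_norm_mul_of_forall_norm_le h (i := i) (fun j => by rw [hζ i, hζ j]) j
    have : switch ζ A i j = (‖A i j‖ : ℂ) := by
      rw [hζ.switch_apply, mul_assoc, hij]
      field_simp [hζ.ne_zero i]
    simp [this]

/-- Maximum principle: subtracting a multiple of `ζ` gives a kernel vector `w` that vanishes at the
root. Its maximal modulus propagates backwards along edges up to the root, hence is `0`. -/
theorem eq_smul_of_laplacian_mulVec_eq_zero {A : Matrix (Fin n) (Fin n) ℂ}
    (hG : HasSpanningTree (graph A)) {ζ y : Fin n → ℂ} (hζ : IsUnimodular ζ)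
    (hLζ : (laplacian A).mulVec ζ = 0) (hy : (laplacian A).mulVec y = 0) :
    ∃ c : ℂ, y = c • ζ := by
  obtain ⟨r, hr⟩ := hG
  refine ⟨y r / ζ r, ?_⟩
  set w := y - (y r / ζ r) • ζ with hw
  have hLw : (laplacian A).mulVec w = 0 := by
    rw [hw, Matrix.mulVec_sub, Matrix.mulVec_smul, hy, hLζ, smul_zero, sub_zero]
  have hwr : w r = 0 := by simp [hw, hζ.ne_zero r]
  have : Nonempty (Fin n) := ⟨r⟩
  obtain ⟨i, hi⟩ := Finite.exists_max fun j => ‖w j‖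
  have hpath : ∀ k, Relation.ReflTransGen (graph A).Adj k i → ‖w k‖ = ‖w i‖ := by
    intro k hk
    induction hk using Relation.ReflTransGen.head_induction_on with
    | refl => rfl
    | @head a b hab _ ih =>
      have hab' : A b a ≠ 0 := hab
      have h := congrArg norm (mul_eq_norm_mul_of_forall_norm_le hLw
        (i := b) (fun j => ih ▸ hi j) a)
      rw [norm_mul, norm_mul, Complex.norm_real, norm_norm] at h
      exact (mul_left_cancel₀ (norm_ne_zero_iff.mpr hab') h).trans ih
  have hwi : ‖w i‖ = 0 := by rw [← hpath r (hr i), hwr, norm_zero]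
  rw [← sub_eq_zero, ← hw]
  funext j
  exact norm_le_zero_iff.mp ((hi j).trans hwi.le)

/-! ### Necessity of the spanning tree. -/

/-- Without a spanning tree there are two disjoint nonempty sets of vertices without incoming
edges. -/
theorem exists_disjoint_closed_of_not_hasSpanningTree (hn : 0 < n) {G : Digraph (Fin n)}
    (hG : ¬ HasSpanningTree G) :
    ∃ C₁ C₂ : Set (Fin n), C₁.Nonempty ∧ C₂.Nonempty ∧ Disjoint C₁ C₂ ∧
      (∀ i j, i ∈ C₁ → G.Adj j i → j ∈ C₁) ∧ ∀ i j, i ∈ C₂ → G.Adj j i → j ∈ C₂ := by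
  have : Nonempty (Fin n) := ⟨⟨0, hn⟩⟩
  let anc : Fin n → Set (Fin n) := fun i => {k | Relation.ReflTransGen G.Adj k i}
  have hclosed : ∀ a i j, i ∈ anc a → G.Adj j i → j ∈ anc a := fun a i j hi hji => hi.head hji
  -- With `r` having the fewest ancestors, an ancestor of `r` that also reaches `i` would have
  -- strictly fewer: `r` is not among them, as `r` does not reach `i`.
  obtain ⟨r, hr⟩ := Finite.exists_min fun i => (anc i).ncard
  simp only [HasSpanningTree, not_exists, not_forall] at hG
  obtain ⟨i, hi⟩ := hG r
  refine ⟨anc i, anc r, ⟨i, .refl⟩, ⟨r, .refl⟩, ?_, hclosed i, hclosed r⟩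
  rw [Set.disjoint_left]
  intro k hki hkr
  have hss : anc k ⊂ anc r := by
    refine Set.ssubset_iff_of_subset (fun l hl => Relation.ReflTransGen.trans hl hkr) |>.mpr
      ⟨r, .refl, fun hrk => hi (Relation.ReflTransGen.trans hrk hki)⟩
  exact absurd (hr k) (not_le.mpr (Set.ncard_lt_ncard hss (Set.toFinite _)))

/-- On a set of vertices without incoming edges the system is autonomous. -/
theorem exp_generator_apply_eq_zero {κ : ℝ} {A : Matrix (Fin n) (Fin n) ℂ} {C : Set (Fin n)}
    (hC : ∀ i j, i ∈ C → (graph A).Adj j i → j ∈ C) {x : Fin n → ℂ} (hx : ∀ i ∈ C, x i = 0)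
    (t : ℝ) {i : Fin n} (hi : i ∈ C) : NormedSpace.exp (t • generator κ A) x i = 0 := by
  let V : Submodule ℂ (Fin n → ℂ) :=
    { carrier := {v | ∀ i ∈ C, v i = 0}
      add_mem' := fun {a b} ha hb i hi => by simp [ha i hi, hb i hi]
      zero_mem' := fun i _ => rfl
      smul_mem' := fun c a ha i hi => by simp [ha i hi] }
  refine exp_apply_mem (V := V) V.closed_of_finiteDimensional (fun v hv j hj => ?_) hx i hi
  have hsum : ∑ k, A j k * v k = 0 := Finset.sum_eq_zero fun k _ => by
    by_cases hjk : A j k = 0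
    · rw [hjk, zero_mul]
    · rw [hv k (hC j k hj hjk), mul_zero]
  simp [generator_apply, laplacian_mulVec_apply, hsum, hv j hj]

/-- If the semigroup fixes a unimodular vector and its limits have entries of equal modulus,
then the digraph has a spanning tree. -/
theorem hasSpanningTree_of_forall_norm_eq (hn : 0 < n) {κ : ℝ} (hκ : 0 < κ)
    {A : Matrix (Fin n) (Fin n) ℂ} {ζ : Fin n → ℂ} (hζ : IsUnimodular ζ)
    (hLζ : (laplacian A).mulVec ζ = 0) {P : (Fin n → ℂ) → Fin n → ℂ}
    (hP : ∀ x, Tendsto (fun t : ℝ => NormedSpace.exp (t • generator κ A) x) atTop (𝓝 (P x)))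
    (hnorm : ∀ x i j, ‖P x i‖ = ‖P x j‖) : HasSpanningTree (graph A) := by
  classical
  by_contra hG
  obtain ⟨C₁, C₂, ⟨i, hi⟩, ⟨j, hj⟩, hdisj, h₁, h₂⟩ :=
    exists_disjoint_closed_of_not_hasSpanningTree hn hG
  let x : Fin n → ℂ := fun k => if k ∈ C₂ then ζ k else 0
  have hPi : P x i = 0 := by
    refine tendsto_nhds_unique (tendsto_pi_nhds.mp (hP x) i) ?_
    have hx : ∀ k ∈ C₁, x k = 0 := fun k hk => if_neg (Set.disjoint_left.mp hdisj hk)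
    simp_rw [exp_generator_apply_eq_zero h₁ hx _ hi]
    exact tendsto_const_nhds
  have hPj : P x j = ζ j := by
    refine tendsto_nhds_unique (tendsto_pi_nhds.mp (hP x) j) ?_
    -- On `C₂` the state `x` evolves like the fixed vector `ζ`.
    have hx : ∀ k ∈ C₂, (x - ζ) k = 0 := fun k hk => by simp [x, hk]
    have h : ∀ t : ℝ, NormedSpace.exp (t • generator κ A) x j = ζ j := fun t => by
      have h' := exp_generator_apply_eq_zero (κ := κ) h₂ hx t hj
      rw [map_sub, exp_smul_apply_of_apply_eq_zero ((generator_apply_eq_zero_iff hκ).mpr hLζ),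
        Pi.sub_apply, sub_eq_zero] at h'
      exact h'
    simp_rw [h]
    exact tendsto_const_nhds
  have := hnorm x i j
  rw [hPi, hPj, norm_zero, hζ j] at this
  exact zero_ne_one this

/-! ### Normalized left eigenvectors. -/

theorem IsNormalizedLeftEigenvector.oneNorm_eq_one {A : Matrix (Fin n) (Fin n) ℂ}
    {ζ η : Fin n → ℂ} (hζ : IsUnimodular ζ) (h : IsNormalizedLeftEigenvector A ζ η) :
    oneNorm η = 1 := by
  obtain ⟨ν, -, h1, -, rfl⟩ := h
  rw [← h1, hζ.inv_diagonal]
  simp [oneNorm, Matrix.mulVec_diagonal, hζ _]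

theorem IsNormalizedLeftEigenvector.vecMul_eq_zero {A : Matrix (Fin n) (Fin n) ℂ}
    {ζ η : Fin n → ℂ} (hζ : IsUnimodular ζ) (h : IsNormalizedLeftEigenvector A ζ η) :
    Matrix.vecMul η (laplacian A) = 0 := by
  obtain ⟨ν, -, -, h0, rfl⟩ := h
  funext j
  have hj := congrFun h0 j
  rw [hζ.inv_diagonal]
  have h2 : Matrix.vecMul ν (switch ζ (laplacian A)) j =
      Matrix.vecMul ((Matrix.diagonal fun i => (ζ i)⁻¹).mulVec ν) (laplacian A) j * ζ j := by
    simp only [Matrix.vecMul, dotProduct, hζ.switch_apply, Matrix.mulVec_diagonal, Finset.sum_mul]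
    exact Finset.sum_congr rfl fun i _ => by ring
  rw [h2, Pi.zero_apply] at hj
  exact (mul_eq_zero.mp hj).resolve_right (hζ.ne_zero j)

theorem IsNormalizedLeftEigenvector.dotProduct_eq_one {A : Matrix (Fin n) (Fin n) ℂ}
    {ζ η : Fin n → ℂ} (hζ : IsUnimodular ζ) (h : IsNormalizedLeftEigenvector A ζ η) :
    η ⬝ᵥ ζ = 1 := by
  obtain ⟨ν, hν, h1, -, rfl⟩ := h
  have h3 : ((∑ i, ‖ν i‖ : ℝ) : ℂ) = 1 := by rw [← oneNorm, h1, Complex.ofReal_one]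
  rw [hζ.inv_diagonal, ← h3, Complex.ofReal_sum]
  refine Finset.sum_congr rfl fun i _ => ?_
  rw [← eq_coe_norm_of_re_nonneg (hν i), Matrix.mulVec_diagonal]
  field_simp [hζ.ne_zero i]

/-- `1 = |∑ η i * ζ i| ≤ ‖η‖₁ ≤ 1` is an equality, so each `η i * ζ i` equals `‖η i‖`; these are the
entries of `ν`. -/
theorem isNormalizedLeftEigenvector_of_oneNorm_le {A : Matrix (Fin n) (Fin n) ℂ}
    {ζ η : Fin n → ℂ} (hζ : IsUnimodular ζ) (hη : Matrix.vecMul η (laplacian A) = 0)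
    (h1 : oneNorm η ≤ 1) (hdot : η ⬝ᵥ ζ = 1) : IsNormalizedLeftEigenvector A ζ η := by
  have hnorm : ∀ i, ‖η i * ζ i‖ = ‖η i‖ := fun i => by rw [norm_mul, hζ i, mul_one]
  have hone : oneNorm η = 1 := by
    refine le_antisymm h1 ?_
    calc (1 : ℝ) = ‖η ⬝ᵥ ζ‖ := by rw [hdot, norm_one]
      _ ≤ ∑ i, ‖η i * ζ i‖ := norm_sum_le _ _
      _ = oneNorm η := by simp_rw [hnorm]; rfl
  have hreal := eq_ofReal_of_sum_eq (b := fun i => η i * ζ i) (c := fun i => ‖η i‖)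
    (fun i => (hnorm i).le)
    (by change η ⬝ᵥ ζ = ((oneNorm η : ℝ) : ℂ); rw [hdot, hone, Complex.ofReal_one])
  refine ⟨fun i => η i * ζ i, fun i => ?_, ?_, ?_, ?_⟩
  · simp only [hreal i]
    simp
  · simp only [oneNorm, hnorm]
    exact hone
  · funext j
    have hj := congrFun hη j
    have h2 : Matrix.vecMul (fun i => η i * ζ i) (switch ζ (laplacian A)) j =
        Matrix.vecMul η (laplacian A) j * ζ j := by
      simp only [Matrix.vecMul, dotProduct, hζ.switch_apply, Finset.sum_mul]
      exact Finset.sum_congr rfl fun i _ => by field_simp [hζ.ne_zero i]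
    rw [h2, hj, Pi.zero_apply, zero_mul]
  · funext i
    rw [hζ.inv_diagonal, Matrix.mulVec_diagonal]
    field_simp [hζ.ne_zero i]

/-- The dual norm of the sup norm is the `ℓ¹` norm. -/
theorem oneNorm_le_of_forall_norm_dotProduct_le {η : Fin n → ℂ} {C : ℝ} (hC : 0 ≤ C)
    (h : ∀ x : Fin n → ℂ, ‖η ⬝ᵥ x‖ ≤ C * ‖x‖) : oneNorm η ≤ C := by
  -- The conjugate phases of `η`; where `η i = 0`, division by zero gives `x i = 0`.
  let x : Fin n → ℂ := fun i => (starRingEnd ℂ) (η i) / ‖η i‖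
  have hx : ‖x‖ ≤ 1 := by
    rw [pi_norm_le_iff_of_nonneg zero_le_one]
    intro i
    simpa [x] using div_self_le_one ‖η i‖
  have hdot : η ⬝ᵥ x = ((oneNorm η : ℝ) : ℂ) := by
    rw [oneNorm, Complex.ofReal_sum]
    refine Finset.sum_congr rfl fun i _ => ?_
    by_cases h0 : η i = 0
    · simp [x, h0]
    · have : (‖η i‖ : ℂ) ≠ 0 := by exact_mod_cast norm_ne_zero_iff.mpr h0
      simp only [x]
      rw [mul_div_assoc', Complex.mul_conj', div_eq_iff this, sq]
  have h0 : 0 ≤ oneNorm η := Finset.sum_nonneg fun i _ => norm_nonneg _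
  calc oneNorm η = ‖η ⬝ᵥ x‖ := by rw [hdot, Complex.norm_real, Real.norm_of_nonneg h0]
    _ ≤ C * ‖x‖ := h x
    _ ≤ C * 1 := by gcongr
    _ = C := mul_one C

/-! ### Almost every initial state, and necessity of both conditions. -/

theorem ae_dotProduct_ne_zero {η ζ : Fin n → ℂ} (h : η ⬝ᵥ ζ ≠ 0) :
    ∀ᵐ x : Fin n → ℂ, η ⬝ᵥ x ≠ 0 := by
  let V : Submodule ℝ (Fin n → ℂ) :=
    { carrier := {x | η ⬝ᵥ x = 0}
      add_mem' := fun {a b} ha hb => by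
        simp only [Set.mem_ofPred_eq] at *
        rw [dotProduct_add, ha, hb, add_zero]
      zero_mem' := dotProduct_zero η
      smul_mem' := fun c a ha => by
        simp only [Set.mem_ofPred_eq] at *
        rw [dotProduct_smul, ha, smul_zero] }
  have hV : V ≠ ⊤ := fun htop => h (show ζ ∈ V by rw [htop]; trivial)
  have h0 := Measure.addHaar_submodule (volume : Measure (Fin n → ℂ)) V hV
  rw [ae_iff]
  convert h0 using 2
  ext x
  simp [V]

/-- The moduli of the entries of the limits agree for every initial state. -/
theorem ReachesComplexConsensus.norm_limit_eq {κ : ℝ} {A : Matrix (Fin n) (Fin n) ℂ}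
    (h : ReachesComplexConsensus κ A) {P : (Fin n → ℂ) →ₗ[ℂ] (Fin n → ℂ)}
    (hP : ∀ x, Tendsto (fun t : ℝ => NormedSpace.exp (t • generator κ A) x) atTop (𝓝 (P x))) :
    (∀ x i j, ‖P x i‖ = ‖P x j‖) ∧ ∃ x, ∀ i, P x i ≠ 0 := by
  have hae : ∀ᵐ x : Fin n → ℂ, ∃ a : ℝ, 0 < a ∧ ∀ i, ‖P x i‖ = a := by
    filter_upwards [h] with x hx
    have h0 : NormedSpace.exp ((0 : ℝ) • generator κ A) x = x :=
      exp_zero_smul_apply _ x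
    obtain ⟨a, ha, hlim⟩ := hx _ (isTrajectory_exp κ A x) h0
    exact ⟨a, ha, fun i =>
      tendsto_nhds_unique (tendsto_pi_nhds.mp (hP x) i).norm (hlim i)⟩
  constructor
  · intro x i j
    have hcont : Continuous P := P.continuous_of_finiteDimensional
    -- A closed condition that holds almost everywhere holds on a dense set, hence everywhere.
    have hclosed : IsClosed {x | ‖P x i‖ = ‖P x j‖} :=
      isClosed_eq ((continuous_apply i).comp hcont).norm ((continuous_apply j).comp hcont).norm
    have hdense : Dense {x | ‖P x i‖ = ‖P x j‖} := Measure.dense_of_ae (μ := volume) <| by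
      filter_upwards [hae] with x ⟨a, _, hx⟩
      rw [hx i, hx j]
    have huniv := hclosed.closure_eq.symm.trans hdense.closure_eq
    exact (huniv.symm ▸ Set.mem_univ x : x ∈ {x | ‖P x i‖ = ‖P x j‖})
  · obtain ⟨x, a, ha, hx⟩ := hae.exists
    exact ⟨x, fun i => norm_pos_iff.mp (by rw [hx i]; exact ha)⟩

theorem ReachesComplexConsensus.essentiallyNonnegative_and_hasSpanningTree (hn : 0 < n) {κ : ℝ}
    (hκ : 0 < κ) {A : Matrix (Fin n) (Fin n) ℂ} (hA : ∀ i, A i i = 0)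
    (h : ReachesComplexConsensus κ A) :
    EssentiallyNonnegative A ∧ HasSpanningTree (graph A) := by
  obtain ⟨P, hLP, -, -, -, hP⟩ := exists_limit_projection hn hκ hA
  obtain ⟨hnorm, x, hx⟩ := h.norm_limit_eq hP
  have hx₀ : (‖P x ⟨0, hn⟩‖ : ℂ) ≠ 0 := by exact_mod_cast norm_ne_zero_iff.mpr (hx _)
  have hζ : IsUnimodular ((‖P x ⟨0, hn⟩‖ : ℂ)⁻¹ • P x) := fun i => by
    rw [Pi.smul_apply, norm_smul, norm_inv, Complex.norm_real, norm_norm, hnorm x i ⟨0, hn⟩]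
    exact inv_mul_cancel₀ (norm_ne_zero_iff.mpr (hx _))
  have hLζ : (laplacian A).mulVec ((‖P x ⟨0, hn⟩‖ : ℂ)⁻¹ • P x) = 0 := by
    rw [Matrix.mulVec_smul, hLP, smul_zero]
  exact ⟨essentiallyNonnegative_iff.mpr ⟨_, hζ, hLζ⟩,
    hasSpanningTree_of_forall_norm_eq hn hκ hζ hLζ hP hnorm⟩

/-! ### The rank-one limit and the main theorem. -/

/-- With a spanning tree, the limit projection has rank one. -/
theorem exists_limit_eq_dotProduct_smul (hn : 0 < n) {κ : ℝ} (hκ : 0 < κ)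
    {A : Matrix (Fin n) (Fin n) ℂ} (hA : ∀ i, A i i = 0) (hG : HasSpanningTree (graph A))
    {ζ : Fin n → ℂ} (hζ : IsUnimodular ζ) (hLζ : (laplacian A).mulVec ζ = 0) :
    ∃ η : Fin n → ℂ, IsNormalizedLeftEigenvector A ζ η ∧
      (∀ θ, IsNormalizedLeftEigenvector A ζ θ → θ = η) ∧
      ∀ x, Tendsto (fun t : ℝ => NormedSpace.exp (t • generator κ A) x) atTop
        (𝓝 ((η ⬝ᵥ x) • ζ)) := by
  obtain ⟨P, hLP, hfix, hPL, hle, hP⟩ := exists_limit_projection hn hκ hA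
  let r : Fin n := ⟨0, hn⟩
  let c : (Fin n → ℂ) →ₗ[ℂ] ℂ := (ζ r)⁻¹ • (LinearMap.proj r ∘ₗ P)
  have hc : ∀ x, P x = c x • ζ := fun x => by
    obtain ⟨a, ha⟩ := eq_smul_of_laplacian_mulVec_eq_zero hG hζ hLζ (hLP x)
    have : c x = a := by simp [c, ha, hζ.ne_zero r, mul_comm a]
    rw [this, ha]
  let η : Fin n → ℂ := fun i => c (Pi.single i 1)
  have hcη : ∀ x, c x = η ⬝ᵥ x := fun x => by
    rw [dotProduct, LinearMap.pi_apply_eq_sum_univ c x]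
    refine Finset.sum_congr rfl fun i _ => ?_
    rw [smul_eq_mul, mul_comm]
    congr 2
    funext j
    simp [Pi.single_apply, eq_comm]
  have hcζ : c ζ = 1 := by simp [c, hfix ζ hLζ, hζ.ne_zero r]
  have hηL : Matrix.vecMul η (laplacian A) = 0 := by
    refine dotProduct_eq_zero _ fun x => ?_
    rw [← Matrix.dotProduct_mulVec, ← hcη]
    simp [c, hPL]
  have hη1 : oneNorm η ≤ 1 := by
    refine oneNorm_le_of_forall_norm_dotProduct_le zero_le_one fun x => ?_
    have h : ‖P x r‖ ≤ ‖x‖ := (norm_le_pi_norm (P x) r).trans (hle x)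
    rw [hc x, Pi.smul_apply, norm_smul, hζ r, mul_one, hcη] at h
    rwa [one_mul]
  have huniq : ∀ θ, IsNormalizedLeftEigenvector A ζ θ → θ = η := fun θ hθ => by
    -- Pairing with `θ` is conserved by the flow, so `θ ⬝ᵥ P x = θ ⬝ᵥ x`; as `P x = c x • ζ` and `θ
    -- ⬝ᵥ ζ = 1`, this identifies `θ` with `η`.
    let φ : (Fin n → ℂ) →L[ℂ] ℂ := ∑ i, θ i • ContinuousLinearMap.proj i
    have hφ : ∀ x, φ x = θ ⬝ᵥ x := fun x => by simp [φ, dotProduct]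
    have hφT : ∀ (t : ℝ) x, φ ((t • generator κ A) x) = 0 := fun t x => by
      have h : θ ⬝ᵥ (laplacian A).mulVec x = 0 := by
        rw [Matrix.dotProduct_mulVec, hθ.vecMul_eq_zero hζ, zero_dotProduct]
      rw [smul_apply, ← Complex.coe_smul, map_smul, generator_apply, map_neg, map_smul, hφ, h]
      simp
    have hφP : ∀ x, φ (P x) = φ x := fun x => by
      refine tendsto_nhds_unique ((φ.continuous.tendsto _).comp (hP x)) ?_
      simp_rw [Function.comp_def, apply_exp_apply_of_forall_apply_eq_zero (hφT _)]
      exact tendsto_const_nhds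
    funext i
    have hi := hφP (Pi.single i 1)
    rw [hc, map_smul, hφ ζ, hθ.dotProduct_eq_one hζ, hφ, dotProduct_single_one] at hi
    simpa using hi.symm
  refine ⟨η, isNormalizedLeftEigenvector_of_oneNorm_le hζ hηL hη1 (hcη ζ ▸ hcζ), huniq, fun x => ?_⟩
  rw [← hcη, ← hc]
  exact hP x

end ComplexConsensus

end

theorem mainTheorem1 {n : ℕ} (hn : 0 < n) (κ : ℝ) (hκ : 0 < κ)
    (A : Matrix (Fin n) (Fin n) ℂ) (hA : ∀ i, A i i = 0) :
    (ComplexConsensus.ReachesComplexConsensus κ A ↔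
      ComplexConsensus.EssentiallyNonnegative A ∧
        ComplexConsensus.HasSpanningTree (ComplexConsensus.graph A)) ∧
    (ComplexConsensus.EssentiallyNonnegative A ∧
        ComplexConsensus.HasSpanningTree (ComplexConsensus.graph A) →
      -- a zero-eigenvector `ζ ∈ 𝕋ⁿ` of `L` exists
      (∃ ζ : Fin n → ℂ, ComplexConsensus.IsUnimodular ζ ∧
        (ComplexConsensus.laplacian A).mulVec ζ = 0) ∧
      ∀ ζ : Fin n → ℂ, ComplexConsensus.IsUnimodular ζ →
        (ComplexConsensus.laplacian A).mulVec ζ = 0 →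
        -- `ζ` is unique up to a scalar, and `η` is uniquely determined by `ζ`
        (∀ y : Fin n → ℂ, (ComplexConsensus.laplacian A).mulVec y = 0 → ∃ c : ℂ, y = c • ζ) ∧
        (∃! η : Fin n → ℂ, ComplexConsensus.IsNormalizedLeftEigenvector A ζ η) ∧
        ∀ η : Fin n → ℂ, ComplexConsensus.IsNormalizedLeftEigenvector A ζ η →
          ComplexConsensus.oneNorm η = 1 ∧
          Matrix.vecMul η (ComplexConsensus.laplacian A) = 0 ∧
          ∀ z : ℝ → Fin n → ℂ, ComplexConsensus.IsTrajectory κ A z →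
            Tendsto z atTop (𝓝 ((η ⬝ᵥ z 0) • ζ))) := by
  have hlim := fun (ζ : Fin n → ℂ) (hG : ComplexConsensus.HasSpanningTree
    (ComplexConsensus.graph A)) (hζ : ComplexConsensus.IsUnimodular ζ)
    (hLζ : (ComplexConsensus.laplacian A).mulVec ζ = 0) =>
      ComplexConsensus.exists_limit_eq_dotProduct_smul hn hκ hA hG hζ hLζ
  refine ⟨⟨fun h => h.essentiallyNonnegative_and_hasSpanningTree hn hκ hA, ?_⟩, ?_⟩
  · rintro ⟨hE, hG⟩
    obtain ⟨ζ, hζ, hLζ⟩ := ComplexConsensus.essentiallyNonnegative_iff.mp hE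
    obtain ⟨η, hη, -, hP⟩ := hlim ζ hG hζ hLζ
    have hdot := hη.dotProduct_eq_one hζ
    filter_upwards [ComplexConsensus.ae_dotProduct_ne_zero (hdot.trans_ne one_ne_zero)]
      with x hx z hz hz0
    refine ⟨‖η ⬝ᵥ x‖, norm_pos_iff.mpr hx, fun i => ?_⟩
    have h := (tendsto_pi_nhds.mp (hz.tendsto (hP (z 0))) i).norm
    rwa [Pi.smul_apply, norm_smul, hζ i, mul_one, hz0] at h
  · rintro ⟨hE, hG⟩
    refine ⟨ComplexConsensus.essentiallyNonnegative_iff.mp hE, fun ζ hζ hLζ => ?_⟩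
    obtain ⟨η, hη, huniq, hP⟩ := hlim ζ hG hζ hLζ
    refine ⟨fun y hy => ComplexConsensus.eq_smul_of_laplacian_mulVec_eq_zero hG hζ hLζ hy,
      ⟨η, hη, huniq⟩, fun θ hθ => ⟨hθ.oneNorm_eq_one hζ, hθ.vecMul_eq_zero hζ, fun z hz => ?_⟩⟩
    rw [huniq θ hθ]
    exact hz.tendsto (hP (z 0))
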